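/- Let $\mathsf{Prop}$ be a set of propositional variables; formulas are built from $\bot$ and the $p\in\mathsf{Prop}$ with $\wedge,\vee,\to$. An *intuitionistic frame* $\mathfrak F=(W,R,\mathcal P)$ is a nonempty partially ordered set $(W,R)$ with a Heyting subalgebra $\mathcal P$ of the algebra of upsets of $(W,R)$. It is a *Kripke frame* if $\mathcal P$ consists of all upsets. It is *descriptive* if it is refined (whenever not $xRy$, some $U\in\mathcal P$ has $x\in U$ and $y\notin U$) and compact (every family of sets, each in $\mathcal P$ or the complement of a member of $\mathcal P$, with the finite intersection property has nonempty intersection). $\mathfrak F\models\varphi$ means that $\varphi$ is true, in the usual intuitionistic Kripke semantics, at every world under every valuation $V$ with all $V(p)\in\mathcal P$. In what follows "frame" means a Kripke frame or a descriptive frame. A frame $\mathfrak G=(W',R',\mathcal P')$ is a *substructure* of $\mathfrak F=(W,R,\mathcal P)$ if $W'\subseteq W$ and $R'=R\restriction W'$; no relation between $\mathcal P'$ and $\mathcal P$ is required. For descriptive frames, $\mathfrak G$ is a *subframe* of $\mathfrak F$ if moreover the topo-subframe condition holds: for every $U\subseteq W'$ with $W'\setminus U\in\mathcal P'$ one has $W\setminus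 R^{-1}(U)\in\mathcal P$. For a node $w$ of a finite $n$-model $\mathfrak N$ (a finite poset with a persistent valuation of $n$ variables $p_1,\dots,p_n$), let $prop(w)$ and $notprop(w)$ be the sets of those $p_i$ that are true, respectively not true, at $w$, and define $\beta(w)=\bigwedge prop(w)\to\bigvee notprop(w)$ if $w$ is maximal, and $\beta(w)=\bigwedge prop(w)\to\bigvee notprop(w)\vee\bigvee_{i=1}^k\beta(w_i)$ otherwise, where $w_1,\dots,w_k$ are the immediate successors of $w$. If $\mathfrak N$ is rooted with root $r$, put $\beta(\mathfrak N)=\beta(r)$. Let $\mathsf B$ be the set of all formulas $\beta(w)$. An *intermediate logic* is a set $L$ of formulas that contains all theorems of the intuitionistic propositional calculus $\mathsf{IPC}$ and is closed under modus ponens and substitution; an *$L$-frame* is a frame in which all formulas of $L$ are valid. $L$ is a *subframe logic* if every subframe of a descriptive $L$-frame is an $L$-frame. $L$ is *canonical* if for every descriptive $L$-frame $(W,R,\mathcal P)$ the underlying Kripke frame $(W,R)$ is an $L$-frame. Then: 1. If $\mathfrak F$ and $\mathfrak G$ are frames (each Kripke or descriptive), $\mathfrak G$ is a substructure of $\mathfrak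 F$, and $\varphi\in\mathsf B$ (in particular, if $\varphi=\beta(\mathfrak N)$ for a finite rooted $n$-model $\mathfrak N$), then $\mathfrak F\models\varphi$ implies $\mathfrak G\models\varphi$. 2. If $L$ is an intermediate subframe logic, then the class of $L$-frames (Kripke or descriptive) is closed under substructures: if $\mathfrak F$ is an $L$-frame and the frame $\mathfrak G$ is a substructure of $\mathfrak F$, then $\mathfrak G$ is an $L$-frame. 3. Every intermediate subframe logic is canonical. -/

import Mathlib

universe u v w

namespace IntLogic

/-- Formulas of intuitionistic propositional logic over the set `α` of propositional variables. -/
inductive Formula (α : Type u) : Type u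
  | bot : Formula α
  | var : α → Formula α
  | and : Formula α → Formula α → Formula α
  | or : Formula α → Formula α → Formula α
  | imp : Formula α → Formula α → Formula α

namespace Formula

variable {α : Type u}

/-- Uniform substitution. -/
def subst (σ : α → Formula α) : Formula α → Formula α
  | bot => bot
  | var p => σ p
  | and φ ψ => and (subst σ φ) (subst σ ψ)
  | or φ ψ => or (subst σ φ) (subst σ ψ)
  | imp φ ψ => imp (subst σ φ) (subst σ ψ)

/-- Finite conjunctions; the empty one is `⊥ → ⊥`. -/
def bigAnd : List (Formula α) → Formula α
  | [] => imp bot bot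
  | [φ] => φ
  | φ :: ψ :: l => and φ (bigAnd (ψ :: l))

/-- Finite disjunctions; the empty one is `⊥`. -/
def bigOr : List (Formula α) → Formula α
  | [] => bot
  | [φ] => φ
  | φ :: ψ :: l => or φ (bigOr (ψ :: l))

end Formula

/-- Theoremhood in the intuitionistic propositional calculus (a Hilbert-style presentation). -/
inductive IPC {α : Type u} : Formula α → Prop
  | k (φ ψ : Formula α) : IPC (.imp φ (.imp ψ φ))
  | s (φ ψ χ : Formula α) :
      IPC (.imp (.imp φ (.imp ψ χ)) (.imp (.imp φ ψ) (.imp φ χ)))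
  | andIntro (φ ψ : Formula α) : IPC (.imp φ (.imp ψ (.and φ ψ)))
  | andLeft (φ ψ : Formula α) : IPC (.imp (.and φ ψ) φ)
  | andRight (φ ψ : Formula α) : IPC (.imp (.and φ ψ) ψ)
  | orLeft (φ ψ : Formula α) : IPC (.imp φ (.or φ ψ))
  | orRight (φ ψ : Formula α) : IPC (.imp ψ (.or φ ψ))
  | orElim (φ ψ χ : Formula α) :
      IPC (.imp (.imp φ χ) (.imp (.imp ψ χ) (.imp (.or φ ψ) χ)))
  | exFalso (φ : Formula α) : IPC (.imp .bot φ)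
  | mp {φ ψ : Formula α} : IPC (.imp φ ψ) → IPC φ → IPC ψ

/-- Intermediate logics: sets of formulas that contain all theorems of `IPC` and are closed under
modus ponens and substitution. -/
structure IsIntermediateLogic {α : Type u} (L : Set (Formula α)) : Prop where
  ipc : ∀ φ, IPC φ → φ ∈ L
  mp : ∀ φ ψ, Formula.imp φ ψ ∈ L → φ ∈ L → ψ ∈ L
  subst : ∀ (σ : α → Formula α) (φ), φ ∈ L → φ.subst σ ∈ L

/-- An intuitionistic frame `(W, ≤, P)`: the set `W` of worlds is nonempty and partially ordered,
and the family `P` of admissible sets is a Heyting subalgebra of the algebra of all upsets. -/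
structure IntFrame (W : Type v) [PartialOrder W] where
  P : Set (Set W)
  nonempty : Nonempty W
  isUpperSet : ∀ U ∈ P, IsUpperSet U
  empty_mem : ∅ ∈ P
  univ_mem : Set.univ ∈ P
  inter_mem : ∀ U ∈ P, ∀ V ∈ P, U ∩ V ∈ P
  union_mem : ∀ U ∈ P, ∀ V ∈ P, U ∪ V ∈ P
  imp_mem : ∀ U ∈ P, ∀ V ∈ P, {x : W | ∀ y, x ≤ y → y ∈ U → y ∈ V} ∈ P

/-- The Kripke frame `(W, ≤)`, in which every upset is admissible. -/
def kripkeFrame (W : Type v) [PartialOrder W] [h : Nonempty W] : IntFrame W where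
  P := {U | IsUpperSet U}
  nonempty := h
  isUpperSet _ hU := hU
  empty_mem := isUpperSet_empty
  univ_mem := isUpperSet_univ
  inter_mem _ hU _ hV := hU.inter hV
  union_mem _ hU _ hV := hU.union hV
  imp_mem _ _ _ _ := fun _ _ hab ha y hy => ha y (hab.trans hy)

namespace IntFrame

variable {W : Type v} [PartialOrder W]

/-- The frame is a Kripke frame. -/
def IsKripke (F : IntFrame W) : Prop :=
  F.P = {U | IsUpperSet U}

/-- The frame is descriptive, that is, refined and compact. -/
structure IsDescriptive (F : IntFrame W) : Prop where
  refined : ∀ x y : W, ¬ x ≤ y → ∃ U ∈ F.P, x ∈ U ∧ y ∉ U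
  compact : ∀ X : Set (Set W), (∀ A ∈ X, A ∈ F.P ∨ Aᶜ ∈ F.P) →
    (∀ Y ⊆ X, Y.Finite → (⋂₀ Y).Nonempty) → (⋂₀ X).Nonempty

end IntFrame

/-- Truth of a formula at a world under the valuation `V`. -/
def Sat {α : Type u} {W : Type v} [PartialOrder W] (V : α → Set W) : W → Formula α → Prop
  | _, .bot => False
  | x, .var p => x ∈ V p
  | x, .and φ ψ => Sat V x φ ∧ Sat V x ψ
  | x, .or φ ψ => Sat V x φ ∨ Sat V x ψ
  | x, .imp φ ψ => ∀ y, x ≤ y → Sat V y φ → Sat V y ψ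

/-- Validity of a formula in a frame: truth at every world under every admissible valuation. -/
def IntFrame.Valid {α : Type u} {W : Type v} [PartialOrder W] (F : IntFrame W)
    (φ : Formula α) : Prop :=
  ∀ V : α → Set W, (∀ p, V p ∈ F.P) → ∀ x, Sat V x φ

/-- `F` is an `L`-frame. -/
def IntFrame.IsFrameOf {α : Type u} {W : Type v} [PartialOrder W] (F : IntFrame W)
    (L : Set (Formula α)) : Prop :=
  ∀ φ ∈ L, F.Valid φ

/-- The topo-subframe condition for a frame `G` on a subset `S` of `F` with the restricted order:
whenever `S \ U` is admissible in `G`, the complement of the downset that `U` generates in `F` is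
admissible in `F`. -/
def IsTopoSubframe {W : Type v} [PartialOrder W] (F : IntFrame W) {S : Set W}
    (G : IntFrame S) : Prop :=
  ∀ U : Set S, Uᶜ ∈ G.P → {x : W | ∃ y ∈ U, x ≤ (y : W)}ᶜ ∈ F.P

/-- Subframe logics: the class of descriptive frames of `L` is closed under (topo-)subframes. -/
def IsSubframeLogic {α : Type u} (L : Set (Formula α)) : Prop :=
  ∀ (W : Type v) [PartialOrder W] (F : IntFrame W) (S : Set W) (G : IntFrame S),
    F.IsDescriptive → G.IsDescriptive → IsTopoSubframe F G →
      F.IsFrameOf L → G.IsFrameOf L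

/-- Canonical logics: the underlying Kripke frame of every descriptive `L`-frame is
an `L`-frame. -/
def IsCanonical {α : Type u} (L : Set (Formula α)) : Prop :=
  ∀ (W : Type v) [PartialOrder W] [Nonempty W] (F : IntFrame W),
    F.IsDescriptive → F.IsFrameOf L → (kripkeFrame W).IsFrameOf L

/-- An `n`-model on the poset `N`: a persistent valuation of `n` variables. -/
structure NModel (n : ℕ) (N : Type w) [PartialOrder N] where
  V : Fin n → Set N
  persistent : ∀ i, IsUpperSet (V i)

namespace NModel

variable {α : Type u} {n : ℕ} {N : Type w} [PartialOrder N]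

open Classical in
/-- The variables, among the given ones `p`, that are true at `x`. -/
noncomputable def prop (M : NModel n N) (p : Fin n ↪ α) (x : N) : List (Formula α) :=
  ((List.finRange n).filter fun i => x ∈ M.V i).map fun i => .var (p i)

open Classical in
/-- The variables, among the given ones `p`, that are not true at `x`. -/
noncomputable def notprop (M : NModel n N) (p : Fin n ↪ α) (x : N) : List (Formula α) :=
  ((List.finRange n).filter fun i => x ∉ M.V i).map fun i => .var (p i)

open Classical in
/-- The immediate successors of `x`, listed in some order. -/
noncomputable def succs [Fintype N] (x : N) : List N :=
  (Finset.univ.filter fun y : N => x ⋖ y).toList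

open Classical in
/-- The formula `β(x)` of a node `x` of a finite `n`-model, written in the variables `p`:
`⋀ prop x → ⋁ notprop x` if `x` is maximal, and
`⋀ prop x → ⋁ notprop x ∨ ⋁ β(y)`, with `y` ranging over the immediate successors of `x`,
if it is not. -/
noncomputable def beta [Fintype N] (M : NModel n N) (p : Fin n ↪ α) (x : N) : Formula α :=
  if IsMax x then
    .imp (.bigAnd (M.prop p x)) (.bigOr (M.notprop p x))
  else
    .imp (.bigAnd (M.prop p x))
      (.or (.bigOr (M.notprop p x))
        (.bigOr ((succs x).attach.map fun y => beta M p y.1)))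
termination_by (Finset.univ.filter fun y : N => x < y).card
decreasing_by
  have hy : x ⋖ y.1 := by
    have := y.2
    simpa [succs] using this
  apply Finset.card_lt_card
  rw [Finset.ssubset_iff_of_subset]
  · exact ⟨y.1, by simpa using hy.lt, by simp⟩
  · intro z hz
    simp only [Finset.mem_filter, Finset.mem_univ, true_and] at hz ⊢
    exact hy.lt.trans hz

end NModel

/-- The class of all formulas `β(x)`, for `x` a node of some finite `n`-model for some `n`.
(For a rooted model `𝔑` with root `r`, `β(𝔑)` is `β(r)`; the formula `β(x)` is `β` of the submodel
generated by `x`.) -/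
def betaFormulas (α : Type u) : Set (Formula α) :=
  {φ | ∃ (n : ℕ) (p : Fin n ↪ α) (N : Type w) (_ : PartialOrder N) (_ : Fintype N)
    (M : NModel n N) (x : N), φ = M.beta p x}

end IntLogic

/-! Everything reduces to finite suborders. By selective filtration, a refuted formula is already
refuted on a finite set of worlds with the restricted order and valuation
(`exists_finite_refutation`). Kripke and descriptive frames are both refined, and in a refined frame
every upset of a finite suborder is the trace of an admissible set.

A refutation of `β(w)` only asserts that certain coloured worlds exist along `≤`, so it survives
monotone colour-preserving maps. A finite refutation in the substructure therefore carries over to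
the larger frame.

For a subframe logic `L`, the claim is that every poset embedding into a refined `L`-frame is a
Kripke frame of `L` (`sat_of_orderEmbedding`); closure under substructures and canonicity are
instances. The finite part of a refutation is embedded into the dual descriptive frame, which still
validates `L`. There, the finite suborder is a p-morphic image of a clopen subset, and clopen
subsets are topo-subframes. -/

namespace IntLogic

universe v'

/-! ### Persistence and refutations of `β` -/

section Sat

variable {α : Type u} {W : Type v} [PartialOrder W] {V : α → Set W}

theorem Sat.mono (hV : ∀ p, IsUpperSet (V p)) {φ : Formula α} {x y : W} (hxy : x ≤ y)
    (h : Sat V x φ) : Sat V y φ := by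
  induction φ with
  | bot => exact h
  | var p => exact hV p hxy h
  | and φ ψ ihφ ihψ => exact ⟨ihφ h.1, ihψ h.2⟩
  | or φ ψ ihφ ihψ => exact h.imp ihφ ihψ
  | imp φ ψ _ _ => exact fun z hz => h z (hxy.trans hz)

theorem sat_bigAnd {x : W} (l : List (Formula α)) :
    Sat V x (.bigAnd l) ↔ ∀ φ ∈ l, Sat V x φ := by
  match l with
  | [] => simp [Formula.bigAnd, Sat]
  | [φ] => simp [Formula.bigAnd]
  | φ :: ψ :: l => simp [Formula.bigAnd, Sat, sat_bigAnd (ψ :: l)]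

theorem sat_bigOr {x : W} (l : List (Formula α)) :
    Sat V x (.bigOr l) ↔ ∃ φ ∈ l, Sat V x φ := by
  match l with
  | [] => simp [Formula.bigOr, Sat]
  | [φ] => simp [Formula.bigOr]
  | φ :: ψ :: l => simp [Formula.bigOr, Sat, sat_bigOr (ψ :: l)]

/-- A world refutes `β(w)` exactly if it sees a world that has the colour of `w` and refutes
`β(w')` for all immediate successors `w'` of `w`. -/
theorem not_sat_beta_iff {n : ℕ} {N : Type w} [PartialOrder N] [Fintype N] (M : NModel n N)
    (p : Fin n ↪ α) (a : N) (x : W) :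
    ¬ Sat V x (M.beta p a) ↔ ∃ y, x ≤ y ∧ (∀ i, y ∈ V (p i) ↔ a ∈ M.V i) ∧
      ∀ b, a ⋖ b → ¬ Sat V y (M.beta p b) := by
  have hprop : ∀ y, Sat V y (.bigAnd (M.prop p a)) ↔ ∀ i, a ∈ M.V i → y ∈ V (p i) := by
    intro y
    simp [sat_bigAnd, NModel.prop, Sat]
  have hnot : ∀ y, Sat V y (.bigOr (M.notprop p a)) ↔ ∃ i, a ∉ M.V i ∧ y ∈ V (p i) := by
    intro y
    simp [sat_bigOr, NModel.notprop, Sat]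
  rw [NModel.beta]
  split_ifs with hmax
  · simp only [Sat, hprop, hnot]
    push Not
    refine exists_congr fun y => and_congr_right fun _ => ⟨fun h => ⟨fun i => ?_, ?_⟩, fun h => ?_⟩
    · by_cases ha : a ∈ M.V i
      · simp [ha, h.1 i ha]
      · simp [ha, h.2 i ha]
    · exact fun b hb => absurd hb.lt hmax.not_lt
    · exact ⟨fun i hi => (h.1 i).2 hi, fun i hi hy => hi ((h.1 i).1 hy)⟩
  · have hsucc : ∀ y, Sat V y (.bigOr ((NModel.succs a).attach.map fun b => M.beta p b.1)) ↔
        ∃ b, a ⋖ b ∧ Sat V y (M.beta p b) := by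
      intro y
      simp [sat_bigOr, NModel.succs]
    simp only [Sat, hprop, hnot, hsucc]
    push Not
    refine exists_congr fun y => and_congr_right fun _ => ⟨fun h => ⟨fun i => ?_, h.2.2⟩, fun h => ?_⟩
    · by_cases ha : a ∈ M.V i
      · simp [ha, h.1 i ha]
      · simp [ha, h.2.1 i ha]
    · exact ⟨fun i hi => (h.1 i).2 hi, fun i hi hy => hi ((h.1 i).1 hy), h.2⟩

/-- Refutations of `β(a)` are transported along monotone colour-preserving maps. -/
theorem not_sat_beta_map {W' : Type v'} [PartialOrder W'] {V' : α → Set W'} (e : W → W')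
    (he : Monotone e) (hV : ∀ p x, e x ∈ V' p ↔ x ∈ V p)
    {n : ℕ} {N : Type w} [PartialOrder N] [Fintype N] (M : NModel n N)
    (p : Fin n ↪ α) (a : N) (x : W) (h : ¬ Sat V x (M.beta p a)) :
    ¬ Sat V' (e x) (M.beta p a) := by
  induction a using WellFoundedGT.induction generalizing x with
  | ind a ih =>
    rw [not_sat_beta_iff] at h ⊢
    obtain ⟨y, hxy, hy, hsucc⟩ := h
    exact ⟨e y, he hxy, fun i => (hV _ _).trans (hy i), fun b hb => ih b hb.lt y (hsucc b hb)⟩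

end Sat

/-! ### Selective filtration -/

section Filtration

variable {α : Type u} {W : Type v} [PartialOrder W] {V : α → Set W}

/-- The pairs `(φ, ψ)` such that `φ → ψ` is a subformula. -/
def Formula.imps : Formula α → Set (Formula α × Formula α)
  | bot => ∅
  | var _ => ∅
  | and φ ψ => imps φ ∪ imps ψ
  | or φ ψ => imps φ ∪ imps ψ
  | imp φ ψ => insert (φ, ψ) (imps φ ∪ imps ψ)

theorem Formula.finite_imps (φ : Formula α) : φ.imps.Finite := by
  induction φ with
  | bot => exact Set.finite_empty
  | var p => exact Set.finite_empty
  | and φ ψ ihφ ihψ => exact ihφ.union ihψ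
  | or φ ψ ihφ ihψ => exact ihφ.union ihψ
  | imp φ ψ ihφ ihψ => exact (ihφ.union ihψ).insert _

/-- Every world lies in a finite set of worlds that contains witnesses for the failure of
finitely many given implications. -/
theorem exists_finite_witnesses (hV : ∀ p, IsUpperSet (V p))
    {I : Set (Formula α × Formula α)} (hI : I.Finite) (x : W) :
    ∃ S : Set W, S.Finite ∧ x ∈ S ∧ ∀ y ∈ S, ∀ i ∈ I, ¬ Sat V y (.imp i.1 i.2) →
      ∃ z ∈ S, y ≤ z ∧ Sat V z i.1 ∧ ¬ Sat V z i.2 := by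
  -- The induction is on the number of antecedents not yet true at `x`. Passing to a witness where a
  -- new antecedent holds lowers it, by persistence; if the antecedent already holds at `x`, then
  -- `x` is itself a witness.
  induction hm : {i ∈ I | ¬ Sat V x i.1}.ncard using Nat.strong_induction_on generalizing x with
  | _ m ih =>
    have key : ∀ i ∈ I, ∃ T : Set W, T.Finite ∧
        (∀ y ∈ T, ∀ j ∈ I, ¬ Sat V y (.imp j.1 j.2) →
          ∃ z ∈ T, y ≤ z ∧ Sat V z j.1 ∧ ¬ Sat V z j.2) ∧
        (¬ Sat V x (.imp i.1 i.2) →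
          ∃ z ∈ insert x T, x ≤ z ∧ Sat V z i.1 ∧ ¬ Sat V z i.2) := by
      intro i hi
      by_cases hx : Sat V x (.imp i.1 i.2)
      · exact ⟨∅, Set.finite_empty, by simp, fun h => absurd hx h⟩
      obtain ⟨z, hxz, hz₁, hz₂⟩ : ∃ z, x ≤ z ∧ Sat V z i.1 ∧ ¬ Sat V z i.2 := by
        simpa [Sat] using hx
      by_cases hx₁ : Sat V x i.1
      · exact ⟨∅, Set.finite_empty, by simp, fun _ =>
          ⟨x, by simp, le_rfl, hx₁, fun h => hz₂ (h.mono hV hxz)⟩⟩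
      · have hlt : {j ∈ I | ¬ Sat V z j.1}.ncard < m := by
          rw [← hm]
          refine Set.ncard_lt_ncard ⟨?_, fun h => ?_⟩ (hI.subset (Set.sep_subset _ _))
          · exact fun j hj => ⟨hj.1, fun h => hj.2 (h.mono hV hxz)⟩
          · exact (h (show i ∈ {j ∈ I | ¬ Sat V x j.1} from ⟨hi, hx₁⟩)).2 hz₁
        obtain ⟨T, hT, hzT, hTw⟩ := ih _ hlt z rfl
        exact ⟨T, hT, hTw, fun _ => ⟨z, Or.inr hzT, hxz, hz₁, hz₂⟩⟩
    choose! T hT hTw hTx using key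
    refine ⟨insert x (⋃ i ∈ I, T i), (hI.biUnion hT).insert x, Set.mem_insert _ _, ?_⟩
    rintro y (rfl | hy) i hi hyi
    · obtain ⟨z, hz, hz'⟩ := hTx i hi hyi
      exact ⟨z, Set.insert_subset_insert (Set.subset_biUnion_of_mem (u := T) hi) hz, hz'⟩
    · obtain ⟨j, hj, hyj⟩ := Set.mem_iUnion₂.1 hy
      obtain ⟨z, hz, hz'⟩ := hTw j hj y hyj i hi hyi
      exact ⟨z, Or.inr (Set.mem_iUnion₂.2 ⟨j, hj, hz⟩), hz'⟩

theorem sat_restrict_iff {S : Set W} (φ : Formula α)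
    (hS : ∀ y ∈ S, ∀ i ∈ φ.imps, ¬ Sat V y (.imp i.1 i.2) →
      ∃ z ∈ S, y ≤ z ∧ Sat V z i.1 ∧ ¬ Sat V z i.2) (y : S) :
    Sat (fun p => (Subtype.val ⁻¹' V p : Set S)) y φ ↔ Sat V (y : W) φ := by
  induction φ generalizing y with
  | bot => rfl
  | var p => rfl
  | and φ ψ ihφ ihψ =>
    exact and_congr (ihφ (fun y hy i hi => hS y hy i (Or.inl hi)) y)
      (ihψ (fun y hy i hi => hS y hy i (Or.inr hi)) y)
  | or φ ψ ihφ ihψ =>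
    exact or_congr (ihφ (fun y hy i hi => hS y hy i (Or.inl hi)) y)
      (ihψ (fun y hy i hi => hS y hy i (Or.inr hi)) y)
  | imp φ ψ ihφ ihψ =>
    replace ihφ := ihφ fun y hy i hi => hS y hy i (Or.inr (Or.inl hi))
    replace ihψ := ihψ fun y hy i hi => hS y hy i (Or.inr (Or.inr hi))
    constructor
    · intro h
      by_contra hn
      obtain ⟨z, hz, hyz, hz₁, hz₂⟩ := hS y y.2 (φ, ψ) (Or.inl rfl) hn
      exact hz₂ ((ihψ ⟨z, hz⟩).1 (h ⟨z, hz⟩ hyz ((ihφ ⟨z, hz⟩).2 hz₁)))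
    · exact fun h z hyz hz => (ihψ z).2 (h z hyz ((ihφ z).1 hz))

/-- Selective filtration: a formula refuted at `x` is refuted at `x` in the restriction of the
model to some finite set of worlds. -/
theorem exists_finite_refutation (hV : ∀ p, IsUpperSet (V p)) {φ : Formula α} {x : W}
    (h : ¬ Sat V x φ) : ∃ (S : Set W) (hx : x ∈ S), S.Finite ∧
      ¬ Sat (fun p => (Subtype.val ⁻¹' V p : Set S)) ⟨x, hx⟩ φ := by
  obtain ⟨S, hS, hx, hw⟩ := exists_finite_witnesses hV φ.finite_imps x
  exact ⟨S, hx, hS, by rwa [sat_restrict_iff φ hw]⟩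

end Filtration

/-! ### Refined frames and their finite suborders -/

namespace IntFrame

variable {W : Type v} [PartialOrder W] {F : IntFrame W}

/-- Distinct principal upsets are separated by admissible sets. -/
def IsRefined (F : IntFrame W) : Prop :=
  ∀ x y : W, ¬ x ≤ y → ∃ U ∈ F.P, x ∈ U ∧ y ∉ U

theorem isRefined (h : F.IsKripke ∨ F.IsDescriptive) : F.IsRefined := by
  rcases h with h | h
  · intro x y hxy
    exact ⟨Set.Ici x, by rw [h]; exact isUpperSet_Ici x, le_rfl, hxy⟩
  · exact h.refined

theorem iInter_mem {ι : Type*} [Finite ι] {U : ι → Set W} (hU : ∀ i, U i ∈ F.P) :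
    ⋂ i, U i ∈ F.P :=
  InfClosed.iInf_mem (s := F.P) (fun _ h _ h' => F.inter_mem _ h _ h') F.univ_mem hU

theorem iUnion_mem {ι : Type*} [Finite ι] {U : ι → Set W} (hU : ∀ i, U i ∈ F.P) :
    ⋃ i, U i ∈ F.P :=
  SupClosed.iSup_mem (s := F.P) (fun _ h _ h' => F.union_mem _ h _ h') F.empty_mem hU

/-- Every upset of a finite suborder of a refined frame is the trace of an admissible set. -/
theorem IsRefined.exists_preimage_eq (hF : F.IsRefined) {Q : Type*} [PartialOrder Q] [Finite Q]
    (e : Q ↪o W) {U : Set Q} (hU : IsUpperSet U) : ∃ U' ∈ F.P, e ⁻¹' U' = U := by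
  have h : ∀ (s : U) (t : ↥Uᶜ), ∃ A ∈ F.P, e s ∈ A ∧ e t ∉ A := fun s t =>
    hF _ _ fun hle => t.2 (hU (e.le_iff_le.1 hle) s.2)
  choose A hA hs ht using h
  refine ⟨⋃ s, ⋂ t, A s t, iUnion_mem fun s => iInter_mem fun t => hA s t, ?_⟩
  ext q
  simp only [Set.mem_preimage, Set.mem_iUnion, Set.mem_iInter]
  constructor
  · rintro ⟨s, h⟩
    by_contra hq
    exact ht s ⟨q, hq⟩ (h ⟨q, hq⟩)
  · exact fun hq => ⟨⟨q, hq⟩, hs ⟨q, hq⟩⟩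

end IntFrame

/-- A finite part of the refutation in `G` embeds into `F`, where its valuation is the trace of an
admissible one. Hence no link between the admissible sets of `F` and `G` is needed. -/
theorem beta_valid_of_substructure {α : Type u} {W : Type v} [PartialOrder W] {F : IntFrame W}
    (hF : F.IsRefined) {S : Set W} (G : IntFrame S) {φ : Formula α}
    (hφ : φ ∈ betaFormulas.{u, w} α) (h : F.Valid φ) : G.Valid φ := by
  obtain ⟨n, p, N, _, _, M, a, rfl⟩ := hφ
  intro V hV x
  by_contra hx
  obtain ⟨T, hxT, hT, hn⟩ := exists_finite_refutation (fun p => G.isUpperSet _ (hV p)) hx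
  have := hT.to_subtype
  let e : T ↪o W := (OrderEmbedding.subtype (· ∈ T)).trans (OrderEmbedding.subtype (· ∈ S))
  have hup : ∀ p, IsUpperSet (Subtype.val ⁻¹' V p : Set T) := fun p a b hab ha =>
    G.isUpperSet _ (hV p) hab ha
  choose V' hV' he using fun p => hF.exists_preimage_eq e (hup p)
  exact not_sat_beta_map e e.monotone (fun p x => Set.ext_iff.1 (he p) x) M p a _ hn
    (h V' hV' _)

/-! ### Clopen sets and clopen subframes -/

namespace IntFrame

variable {W : Type v} [PartialOrder W] (F : IntFrame W)

/-- The Boolean combinations of admissible sets. In a descriptive frame, these are the clopen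
sets of the topology in which the admissible sets and their complements are a subbase. -/
def clopens : BooleanSubalgebra (Set W) :=
  BooleanSubalgebra.closure F.P

variable {F}

theorem mem_clopens {U : Set W} (hU : U ∈ F.P) : U ∈ F.clopens :=
  BooleanSubalgebra.subset_closure hU

/-- A Boolean combination of admissible sets is a finite union of differences `U \ V`. For one
difference the set in question is the Heyting implication of `U` and `V`; unions turn into
intersections. -/
theorem compl_lowerClosure_mem {K : Set W} (hK : K ∈ F.clopens) :
    {x | ∃ y ∈ K, x ≤ y}ᶜ ∈ F.P := by
  have hsub : IsSublattice F.P :=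
    ⟨fun _ h _ h' => F.union_mem _ h _ h', fun _ h _ h' => F.inter_mem _ h _ h'⟩
  induction K, hK using
    BooleanSubalgebra.closure_sdiff_sup_induction hsub F.empty_mem F.univ_mem with
  | sdiff U hU V hV =>
    convert F.imp_mem U hU V hV using 1
    ext x
    simp only [Set.mem_compl_iff, Set.mem_ofPred_eq, Set.mem_sdiff]
    grind
  | sup K _ L _ ihK ihL =>
    convert F.inter_mem _ ihK _ ihL using 1
    ext x
    simp only [Set.mem_compl_iff, Set.mem_ofPred_eq, Set.sup_eq_union, Set.mem_union,
      Set.mem_inter_iff]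
    grind

/-- Every ultrafilter on a descriptive frame converges. -/
theorem IsDescriptive.exists_forall_mem_iff (hF : F.IsDescriptive) (f : Ultrafilter W) :
    ∃ x, ∀ K ∈ F.clopens, x ∈ K ↔ K ∈ f := by
  obtain ⟨x, hx⟩ := hF.compact {A | A ∈ f ∧ (A ∈ F.P ∨ Aᶜ ∈ F.P)} (fun A hA => hA.2)
    fun Y hY hfin => Ultrafilter.nonempty_of_mem
      (f := f) ((Filter.sInter_mem hfin).2 fun A hA => (hY hA).1)
  refine ⟨x, fun K hK => ?_⟩
  induction hK using BooleanSubalgebra.closure_bot_sup_induction with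
  | mem U hU =>
    refine ⟨fun h => ?_, fun h => hx U ⟨h, Or.inl hU⟩⟩
    by_contra hn
    exact hx Uᶜ ⟨Ultrafilter.compl_mem_iff_notMem.2 hn, Or.inr (by rwa [compl_compl])⟩ h
  | bot => simp
  | sup K _ L _ ihK ihL => simp [ihK, ihL]
  | compl K _ ih => rw [Set.mem_compl_iff, ih, Ultrafilter.compl_mem_iff_notMem]

/-- The frame on a clopen subset of an intuitionistic frame in which the relatively clopen upsets
are admissible. -/
def restrict (F : IntFrame W) (S : Set W) (hS : S ∈ F.clopens) (hne : S.Nonempty) :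
    IntFrame S where
  P := {U | IsUpperSet U ∧ Subtype.val '' U ∈ F.clopens}
  nonempty := hne.to_subtype
  isUpperSet _ hU := hU.1
  empty_mem := ⟨isUpperSet_empty, by
    rw [Set.image_empty]; exact BooleanSubalgebra.bot_mem⟩
  univ_mem := ⟨isUpperSet_univ, by simpa using hS⟩
  inter_mem U hU V hV := ⟨hU.1.inter hV.1, by
    rw [Set.image_inter Subtype.val_injective]
    exact BooleanSubalgebra.inf_mem hU.2 hV.2⟩
  union_mem U hU V hV := ⟨hU.1.union hV.1, by
    rw [Set.image_union]
    exact BooleanSubalgebra.sup_mem hU.2 hV.2⟩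
  imp_mem U hU V hV := by
    refine ⟨fun a b hab ha y hy => ha y (hab.trans hy), ?_⟩
    convert BooleanSubalgebra.inf_mem hS (mem_clopens (compl_lowerClosure_mem
      (BooleanSubalgebra.sdiff_mem hU.2 hV.2))) using 1
    ext x
    simp only [Set.mem_image, Set.mem_ofPred_eq, Set.inf_eq_inter, Set.mem_inter_iff,
      Set.mem_compl_iff, Set.mem_sdiff]
    constructor
    · rintro ⟨a, ha, rfl⟩
      refine ⟨a.2, ?_⟩
      rintro ⟨_, ⟨⟨y, hy, rfl⟩, hn⟩, hay⟩
      exact hn ⟨y, ha y hay hy, rfl⟩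
    · rintro ⟨hx, h⟩
      refine ⟨⟨x, hx⟩, fun y hxy hy => ?_, rfl⟩
      by_contra hn
      exact h ⟨y, ⟨⟨y, hy, rfl⟩, fun ⟨z, hz, hzy⟩ => hn (Subtype.ext hzy ▸ hz)⟩, hxy⟩

section Restrict

variable {S : Set W} (hS : S ∈ F.clopens) (hne : S.Nonempty)

theorem image_compl_mem_clopens {U : Set S} (hS : S ∈ F.clopens)
    (hU : Subtype.val '' U ∈ F.clopens) : Subtype.val '' Uᶜ ∈ F.clopens := by
  rw [Set.image_compl_eq_range_sdiff_image Subtype.val_injective, Subtype.range_val]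
  exact BooleanSubalgebra.sdiff_mem hS hU

theorem isTopoSubframe_restrict : IsTopoSubframe F (F.restrict S hS hne) := by
  intro U hU
  have h := image_compl_mem_clopens hS hU.2
  rw [compl_compl] at h
  convert compl_lowerClosure_mem h using 2
  ext x
  simp

theorem IsDescriptive.restrict (hF : F.IsDescriptive) : (F.restrict S hS hne).IsDescriptive where
  refined x y hxy := by
    obtain ⟨U, hU, hx, hy⟩ := hF.refined x y hxy
    refine ⟨Subtype.val ⁻¹' U, ⟨fun a b hab ha => F.isUpperSet U hU hab ha, ?_⟩, hx, hy⟩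
    rw [Subtype.image_preimage_coe]
    exact BooleanSubalgebra.inf_mem hS (mem_clopens hU)
  compact X hX hfip := by
    obtain ⟨f, hf⟩ := Ultrafilter.exists_ultrafilter_of_finite_inter_nonempty X
      fun T hT => hfip T hT T.finite_toSet
    -- An ultrafilter extending `X` is pushed forward to `W`; its limit stays in `S` because `S` is
    -- clopen.
    obtain ⟨x, hx⟩ := hF.exists_forall_mem_iff (f.map Subtype.val)
    have hxS : x ∈ S := (hx S hS).2 (by
      rw [Ultrafilter.mem_map, Subtype.coe_preimage_self]; exact Filter.univ_mem)
    refine ⟨⟨x, hxS⟩, fun A hA => ?_⟩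
    have hAc : Subtype.val '' A ∈ F.clopens := by
      rcases hX A hA with h | h
      · exact h.2
      · simpa using image_compl_mem_clopens hS h.2
    have hxA := (hx _ hAc).2 (by
      rw [Ultrafilter.mem_map, Set.preimage_image_eq _ Subtype.val_injective]; exact hf hA)
    simpa [hxS] using hxA

end Restrict

end IntFrame

/-! ### Finite suborders as p-morphic images of clopen subframes -/

section Realization

variable {W : Type v} [PartialOrder W] {Q : Type v'} [PartialOrder Q]

/-- The worlds that realize a node `s` of a poset coloured by `C`: they have the colour of `s` and
see realizations of all nodes above `s`. -/
inductive Realizes (C : Q → Set W) : Q → W → Prop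
  | mk (s : Q) (x : W) (hx : x ∈ C s) (y : ∀ t, s < t → W) (hle : ∀ t ht, x ≤ y t ht)
      (hy : ∀ t ht, Realizes C t (y t ht)) : Realizes C s x

theorem realizes_iff {C : Q → Set W} {s : Q} {x : W} :
    Realizes C s x ↔ x ∈ C s ∧ ∀ t, s < t → ∃ y, Realizes C t y ∧ x ≤ y := by
  constructor
  · rintro ⟨_, _, hx, y, hle, hy⟩
    exact ⟨hx, fun t ht => ⟨y t ht, hy t ht, hle t ht⟩⟩
  · rintro ⟨hx, h⟩
    choose y hy hle using h
    exact .mk s x hx y hle hy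

/-- Downsets of clopen sets are clopen, and only finitely many nodes lie above `s`, so the recursion
stays within the clopen sets. -/
theorem setOf_realizes_mem_clopens {F : IntFrame W} [Finite Q] {C : Q → Set W}
    (hC : ∀ s, C s ∈ F.clopens) (s : Q) : {x | Realizes C s x} ∈ F.clopens := by
  induction s using WellFoundedGT.induction with
  | ind s ih =>
    have h : {x | Realizes C s x} =
        C s ⊓ ⨅ t : Set.Ioi s, {x | ∃ y ∈ {y | Realizes C (t : Q) y}, x ≤ y} := by
      ext x
      simp [realizes_iff (s := s)]
    rw [h]
    refine BooleanSubalgebra.inf_mem (hC s) (BooleanSubalgebra.iInf_mem fun t => ?_)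
    rw [← BooleanSubalgebra.compl_mem_iff]
    exact IntFrame.mem_clopens (IntFrame.compl_lowerClosure_mem (ih t t.2))

/-- In a refined frame, a finite suborder can be coloured by clopen sets in such a way that the
order of the colours determines the order of the nodes. -/
theorem IntFrame.IsRefined.exists_coloring {F : IntFrame W} (hF : F.IsRefined) [Finite Q]
    (e : Q ↪o W) : ∃ C : Q → Set W, (∀ s, C s ∈ F.clopens) ∧ (∀ s, e s ∈ C s) ∧
      ∀ s t x y, x ∈ C s → y ∈ C t → x ≤ y → s ≤ t := by
  choose U hU he using fun s => hF.exists_preimage_eq e (isUpperSet_Ici (a := s))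
  have hmem : ∀ s t, e t ∈ U s ↔ s ≤ t := fun s t => Set.ext_iff.1 (he s) t
  -- `U s` traces the principal upset of `s`. If `x ≤ y` with `x` of colour `s`, then `y ∈ U s`,
  -- which colour `t` excludes unless `s ≤ t`.
  refine ⟨fun s => U s \ ⋃ t : {t // ¬ t ≤ s}, U t, fun s => ?_, fun s => ?_, ?_⟩
  · exact BooleanSubalgebra.sdiff_mem (mem_clopens (hU s))
      (mem_clopens (iUnion_mem fun t => hU t))
  · simp [hmem]
  · intro s t x y hx hy hxy
    by_contra hst
    exact hy.2 (Set.mem_iUnion.2 ⟨⟨s, hst⟩, F.isUpperSet _ (hU s) hxy hx.1⟩)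

/-- Finite suborders of a descriptive frame of a subframe logic `L` are Kripke frames of `L`. -/
theorem sat_of_orderEmbedding_of_isDescriptive {α : Type u} {L : Set (Formula α)}
    (hL : IsSubframeLogic.{u, v} L) {F : IntFrame W} (hF : F.IsDescriptive) (hFL : F.IsFrameOf L)
    [Finite Q] (e : Q ↪o W) {V : α → Set Q} (hV : ∀ p, IsUpperSet (V p))
    {φ : Formula α} (hφ : φ ∈ L) (s : Q) : Sat V s φ := by
  obtain ⟨C, hC, heC, hle⟩ := IntFrame.IsRefined.exists_coloring (F := F) hF.refined e
  have heA : ∀ s, Realizes C s (e s) := by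
    intro s
    induction s using WellFoundedGT.induction with
    | ind s ih => exact realizes_iff.2 ⟨heC s, fun t ht => ⟨e t, ih t ht, e.monotone ht.le⟩⟩
  have hAle : ∀ s t x y, Realizes C s x → Realizes C t y → x ≤ y → s ≤ t := fun s t x y hx hy =>
    hle s t x y (realizes_iff.1 hx).1 (realizes_iff.1 hy).1
  let S : Set W := ⋃ s, {x | Realizes C s x}
  have hS : S ∈ F.clopens := BooleanSubalgebra.iSup_mem fun s => setOf_realizes_mem_clopens hC s
  have hmem : ∀ {s x}, Realizes C s x → x ∈ S := fun {s x} h => Set.mem_iUnion.2 ⟨s, h⟩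
  have hne : S.Nonempty := ⟨e s, hmem (heA s)⟩
  let V' : α → Set S := fun p => {x | ∃ s ∈ V p, Realizes C s x}
  have hV' : ∀ p, V' p ∈ (F.restrict S hS hne).P := by
    intro p
    constructor
    · rintro x y hxy ⟨s, hs, hx⟩
      obtain ⟨t, ht⟩ := Set.mem_iUnion.1 y.2
      exact ⟨t, hV p (hAle s t x y hx ht hxy) hs, ht⟩
    · have h : Subtype.val '' V' p = ⨆ s : V p, {x | Realizes C (s : Q) x} := by
        ext x
        simp only [Set.mem_image, Set.iSup_eq_iUnion, Set.mem_iUnion, Set.mem_ofPred_eq, V']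
        constructor
        · rintro ⟨y, ⟨s, hs, hy⟩, rfl⟩
          exact ⟨⟨s, hs⟩, hy⟩
        · rintro ⟨s, hx⟩
          exact ⟨⟨x, hmem hx⟩, ⟨s, s.2, hx⟩, rfl⟩
      rw [h]
      exact BooleanSubalgebra.iSup_mem fun s => setOf_realizes_mem_clopens hC s
  -- Sending a world to the node it realizes is a p-morphism from `S` to `Q`: `hAle` makes it well
  -- defined and monotone, and the definition of `Realizes` gives the back condition.
  have hsat : ∀ ψ : Formula α, ∀ (x : S) s, Realizes C s (x : W) → (Sat V' x ψ ↔ Sat V s ψ) := by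
    intro ψ
    induction ψ with
    | bot => exact fun _ _ _ => Iff.rfl
    | var p =>
      intro x s hx
      refine ⟨?_, fun h => ⟨s, h, hx⟩⟩
      rintro ⟨t, ht, hxt⟩
      exact hV p (hAle t s x x hxt hx le_rfl) ht
    | and ψ χ ihψ ihχ => exact fun x s hx => and_congr (ihψ x s hx) (ihχ x s hx)
    | or ψ χ ihψ ihχ => exact fun x s hx => or_congr (ihψ x s hx) (ihχ x s hx)
    | imp ψ χ ihψ ihχ =>
      intro x s hx
      constructor
      · intro h t hst ht
        obtain ⟨y, hy, hxy⟩ : ∃ y, Realizes C t y ∧ (x : W) ≤ y := by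
          rcases hst.eq_or_lt with rfl | hlt
          · exact ⟨x, hx, le_rfl⟩
          · exact (realizes_iff.1 hx).2 t hlt
        exact (ihχ ⟨y, hmem hy⟩ t hy).1 (h ⟨y, hmem hy⟩ hxy ((ihψ ⟨y, hmem hy⟩ t hy).2 ht))
      · intro h y hxy hy
        obtain ⟨t, ht⟩ := Set.mem_iUnion.1 y.2
        exact (ihχ y t ht).2 (h t (hAle s t x y hx ht hxy) ((ihψ y t ht).1 hy))
  have hG := hL W F S (F.restrict S hS hne) hF (hF.restrict hS hne)
    (IntFrame.isTopoSubframe_restrict hS hne) hFL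
  exact (hsat φ ⟨e s, hmem (heA s)⟩ s (heA s)).1 (hG φ hφ V' hV' _)

end Realization

/-! ### The dual descriptive frame -/

section PrimeFilter

variable {W : Type v} [PartialOrder W]

/-- Prime filters of the Heyting algebra of admissible sets. -/
structure IntFrame.IsPrimeFilter (F : IntFrame W) (x : Set (Set W)) : Prop where
  subset : x ⊆ F.P
  univ_mem : Set.univ ∈ x
  mono : ∀ U ∈ x, ∀ V ∈ F.P, U ⊆ V → V ∈ x
  inter_mem : ∀ U ∈ x, ∀ V ∈ x, U ∩ V ∈ x
  empty_notMem : ∅ ∉ x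
  mem_or_mem : ∀ U ∈ F.P, ∀ V ∈ F.P, U ∪ V ∈ x → U ∈ x ∨ V ∈ x

namespace IntFrame

variable (F : IntFrame W)

theorem isPrimeFilter_ultrafilter (f : Ultrafilter W) : F.IsPrimeFilter {U ∈ F.P | U ∈ f} where
  subset _ hU := hU.1
  univ_mem := ⟨F.univ_mem, Filter.univ_mem⟩
  mono _ hU _ hV h := ⟨hV, Filter.mem_of_superset hU.2 h⟩
  inter_mem _ hU _ hV := ⟨F.inter_mem _ hU.1 _ hV.1, Filter.inter_mem hU.2 hV.2⟩
  empty_notMem h := f.empty_notMem h.2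
  mem_or_mem _ hU _ hV h := (Ultrafilter.union_mem_iff.1 h.2).imp (⟨hU, ·⟩) (⟨hV, ·⟩)

/-- The set of prime filters of the algebra of admissible sets, ordered by inclusion. -/
abbrev PrimeFilters : Type v := {x : Set (Set W) // F.IsPrimeFilter x}

/-- The set of prime filters that contain `U`. -/
def basicSet (U : Set W) : Set F.PrimeFilters := {x | U ∈ x.1}

variable {F}

/-- If `x` omits the implication, every member of `x` meets `U \ V`. An ultrafilter on `W`
containing all these intersections then yields a prime filter above `x` that contains `U` and omits
`V`. -/
theorem basicSet_imp {U V : Set W} (hU : U ∈ F.P) (hV : V ∈ F.P) :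
    F.basicSet {x | ∀ y, x ≤ y → y ∈ U → y ∈ V} =
      {x | ∀ y, x ≤ y → y ∈ F.basicSet U → y ∈ F.basicSet V} := by
  have hI := F.imp_mem U hU V hV
  ext x
  constructor
  · intro hx y hxy hy
    refine y.2.mono _ (y.2.inter_mem _ (hxy hx) _ hy) V hV ?_
    exact fun a ha => ha.1 a le_rfl ha.2
  · intro h
    by_contra hx
    have hne : ∀ A ∈ x.1, (A ∩ (U \ V)).Nonempty := by
      intro A hA
      by_contra hn
      refine hx (x.2.mono A hA _ hI fun a ha b hab hb => ?_)
      by_contra hbV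
      exact hn ⟨b, F.isUpperSet A (x.2.subset hA) hab ha, hb, hbV⟩
    obtain ⟨f, hf⟩ := Ultrafilter.exists_ultrafilter_of_finite_inter_nonempty
      ((fun A => A ∩ (U \ V)) '' x.1) (fun T hT => by
        have : ∃ A ∈ x.1, A ∩ (U \ V) ⊆ ⋂₀ (T : Set (Set W)) := by
          induction T using Finset.induction_on with
          | empty => exact ⟨_, x.2.univ_mem, by simp⟩
          | insert B T _ ih =>
            rw [Finset.coe_insert, Set.insert_subset_iff] at hT
            obtain ⟨A, hA, hAT⟩ := ih hT.2
            obtain ⟨A', hA', rfl⟩ := hT.1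
            refine ⟨A ∩ A', x.2.inter_mem _ hA _ hA', ?_⟩
            rw [Finset.coe_insert, Set.sInter_insert]
            exact fun a ha => ⟨⟨ha.1.2, ha.2⟩, hAT ⟨ha.1.1, ha.2⟩⟩
        obtain ⟨A, hA, hAT⟩ := this
        exact (hne A hA).mono hAT)
    have hxf : ∀ A ∈ x.1, A ∩ (U \ V) ∈ f := fun A hA => hf ⟨A, hA, rfl⟩
    have hUV : U \ V ∈ f := Filter.mem_of_superset (hxf _ x.2.univ_mem) Set.inter_subset_right
    have hy := h ⟨_, F.isPrimeFilter_ultrafilter f⟩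
      (fun A hA => ⟨x.2.subset hA, Filter.mem_of_superset (hxf A hA) Set.inter_subset_left⟩)
      ⟨hU, Filter.mem_of_superset hUV Set.sdiff_subset⟩
    exact ((Ultrafilter.sdiff_mem_iff f).1 hUV).2 hy.2

theorem basicSet_inter {U V : Set W} (hU : U ∈ F.P) (hV : V ∈ F.P) :
    F.basicSet (U ∩ V) = F.basicSet U ∩ F.basicSet V :=
  Set.ext fun x => ⟨fun h => ⟨x.2.mono _ h U hU Set.inter_subset_left,
    x.2.mono _ h V hV Set.inter_subset_right⟩, fun h => x.2.inter_mem _ h.1 _ h.2⟩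

theorem basicSet_union {U V : Set W} (hU : U ∈ F.P) (hV : V ∈ F.P) :
    F.basicSet (U ∪ V) = F.basicSet U ∪ F.basicSet V :=
  Set.ext fun x => ⟨x.2.mem_or_mem U hU V hV, fun h =>
    h.elim (fun h => x.2.mono _ h _ (F.union_mem _ hU _ hV) Set.subset_union_left)
      (fun h => x.2.mono _ h _ (F.union_mem _ hU _ hV) Set.subset_union_right)⟩

/-- The prime filter of the admissible sets that contain a given world. -/
def principal (F : IntFrame W) (a : W) : F.PrimeFilters :=
  ⟨{U ∈ F.P | a ∈ U}, F.isPrimeFilter_ultrafilter (pure a)⟩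

/-- The descriptive frame dual to the Heyting algebra of admissible sets. -/
def dual (F : IntFrame W) : IntFrame F.PrimeFilters where
  P := F.basicSet '' F.P
  nonempty := F.nonempty.map F.principal
  isUpperSet := by
    rintro _ ⟨U, _, rfl⟩ x y hxy hx
    exact hxy hx
  empty_mem := ⟨∅, F.empty_mem, Set.eq_empty_of_forall_notMem fun x => x.2.empty_notMem⟩
  univ_mem := ⟨Set.univ, F.univ_mem, Set.eq_univ_of_forall fun x => x.2.univ_mem⟩
  inter_mem := by
    rintro _ ⟨U, hU, rfl⟩ _ ⟨V, hV, rfl⟩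
    exact ⟨_, F.inter_mem U hU V hV, basicSet_inter hU hV⟩
  union_mem := by
    rintro _ ⟨U, hU, rfl⟩ _ ⟨V, hV, rfl⟩
    exact ⟨_, F.union_mem U hU V hV, basicSet_union hU hV⟩
  imp_mem := by
    rintro _ ⟨U, hU, rfl⟩ _ ⟨V, hV, rfl⟩
    exact ⟨_, F.imp_mem U hU V hV, basicSet_imp hU hV⟩

theorem isDescriptive_dual : F.dual.IsDescriptive where
  refined x y hxy := by
    obtain ⟨U, hU, hUy⟩ := Set.not_subset.1 hxy
    exact ⟨_, ⟨U, x.2.subset hU, rfl⟩, hU, hUy⟩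
  compact X hX hfip := by
    obtain ⟨f, hf⟩ := Ultrafilter.exists_ultrafilter_of_finite_inter_nonempty X
      fun T hT => hfip T hT T.finite_toSet
    -- This is the limit of `f`: it lies in exactly those basic sets of admissible sets that belong
    -- to `f`.
    let x : F.PrimeFilters := ⟨{U ∈ F.P | F.basicSet U ∈ f}, {
      subset := fun _ hU => hU.1
      univ_mem := ⟨F.univ_mem, Filter.mem_of_superset Filter.univ_mem fun y _ => y.2.univ_mem⟩
      mono := fun U hU V hV h => ⟨hV, Filter.mem_of_superset hU.2 fun y hy => y.2.mono U hy V hV h⟩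
      inter_mem := fun U hU V hV => ⟨F.inter_mem _ hU.1 _ hV.1, by
        rw [basicSet_inter hU.1 hV.1]; exact Filter.inter_mem hU.2 hV.2⟩
      empty_notMem := fun h => by
        obtain ⟨y, hy⟩ := f.nonempty_of_mem h.2
        exact y.2.empty_notMem hy
      mem_or_mem := fun U hU V hV h => by
        have h' := h.2
        rw [basicSet_union hU hV, Ultrafilter.union_mem_iff] at h'
        exact h'.imp (⟨hU, ·⟩) (⟨hV, ·⟩) }⟩
    refine ⟨x, fun A hA => ?_⟩
    rcases hX A hA with ⟨U, hU, rfl⟩ | ⟨U, hU, hUA⟩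
    · exact ⟨hU, hf hA⟩
    · by_contra hn
      have hxU : x ∈ F.basicSet U := by rw [hUA]; exact hn
      have hUf := hxU.2
      rw [hUA, Ultrafilter.compl_mem_iff_notMem] at hUf
      exact hUf (hf hA)

theorem setOf_sat_mem {α : Type u} {V : α → Set W} (hV : ∀ p, V p ∈ F.P) (φ : Formula α) :
    {x | Sat V x φ} ∈ F.P := by
  induction φ with
  | bot => exact F.empty_mem
  | var p => exact hV p
  | and φ ψ ihφ ihψ => exact F.inter_mem _ ihφ _ ihψ
  | or φ ψ ihφ ihψ => exact F.union_mem _ ihφ _ ihψ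
  | imp φ ψ ihφ ihψ => exact F.imp_mem _ ihφ _ ihψ

theorem setOf_sat_dual {α : Type u} {V : α → Set W} (hV : ∀ p, V p ∈ F.P) (φ : Formula α) :
    {x | Sat (fun p => F.basicSet (V p)) x φ} = F.basicSet {x | Sat V x φ} := by
  induction φ with
  | bot => exact (Set.eq_empty_of_forall_notMem fun x => x.2.empty_notMem).symm
  | var p => rfl
  | and φ ψ ihφ ihψ =>
    refine Eq.trans ?_ (basicSet_inter (setOf_sat_mem hV φ) (setOf_sat_mem hV ψ)).symm
    rw [← ihφ, ← ihψ]
    rfl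
  | or φ ψ ihφ ihψ =>
    refine Eq.trans ?_ (basicSet_union (setOf_sat_mem hV φ) (setOf_sat_mem hV ψ)).symm
    rw [← ihφ, ← ihψ]
    rfl
  | imp φ ψ ihφ ihψ =>
    refine Eq.trans ?_ (basicSet_imp (setOf_sat_mem hV φ) (setOf_sat_mem hV ψ)).symm
    rw [← ihφ, ← ihψ]
    rfl

/-- Every admissible valuation on the dual comes from one on `F`, and a formula true everywhere in
`F` has truth set `Set.univ`, a member of every prime filter. -/
theorem Valid.dual {α : Type u} {φ : Formula α} (h : F.Valid φ) : F.dual.Valid φ := by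
  intro V hV x
  choose U hU hUV using hV
  obtain rfl : (fun p => F.basicSet (U p)) = V := funext hUV
  have hx : x ∈ F.basicSet {x | Sat U x φ} := by
    rw [show {x | Sat U x φ} = Set.univ from Set.eq_univ_of_forall (h U hU)]
    exact x.2.univ_mem
  rwa [← setOf_sat_dual hU] at hx

/-- A refined frame embeds into its descriptive completion. -/
def IsRefined.toDual (hF : F.IsRefined) : W ↪o F.PrimeFilters :=
  OrderEmbedding.ofMapLEIff F.principal fun a b => by
    refine ⟨fun h => ?_, fun h U hU => ⟨hU.1, F.isUpperSet U hU.1 h hU.2⟩⟩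
    by_contra hab
    obtain ⟨U, hU, ha, hb⟩ := hF a b hab
    exact hb (h ⟨hU, ha⟩).2

end IntFrame

end PrimeFilter

/-- Every poset that embeds into a refined frame of a subframe logic `L` is a Kripke frame
of `L`. -/
theorem sat_of_orderEmbedding {α : Type u} {L : Set (Formula α)}
    (hL : IsSubframeLogic.{u, v} L) {W : Type v} [PartialOrder W] {F : IntFrame W}
    (hF : F.IsRefined) (hFL : F.IsFrameOf L) {Q : Type v'} [PartialOrder Q] (e : Q ↪o W)
    {V : α → Set Q} (hV : ∀ p, IsUpperSet (V p)) {φ : Formula α} (hφ : φ ∈ L) (x : Q) :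
    Sat V x φ := by
  by_contra hx
  obtain ⟨T, hxT, hT, hn⟩ := exists_finite_refutation hV hx
  have := hT.to_subtype
  exact hn (sat_of_orderEmbedding_of_isDescriptive hL IntFrame.isDescriptive_dual
    (fun ψ hψ => (hFL ψ hψ).dual)
    (((OrderEmbedding.subtype (· ∈ T)).trans e).trans hF.toDual)
    (fun p a b hab ha => hV p hab ha) hφ _)

end IntLogic

theorem corollary4p11 {α : Type u} :
    -- validity of the formulas `β(𝔑)` is preserved by arbitrary substructures
    (∀ (W : Type v) [PartialOrder W] (F : IntLogic.IntFrame W)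
        (S : Set W) (G : IntLogic.IntFrame S),
        (F.IsKripke ∨ F.IsDescriptive) → (G.IsKripke ∨ G.IsDescriptive) →
          ∀ φ ∈ IntLogic.betaFormulas.{u, w} α, F.Valid φ → G.Valid φ) ∧
    (∀ L : Set (IntLogic.Formula α), IntLogic.IsIntermediateLogic L →
      IntLogic.IsSubframeLogic.{u, v} L →
        -- the class of frames of `L` is closed under arbitrary substructures
        (∀ (W : Type v) [PartialOrder W] (F : IntLogic.IntFrame W)
          (S : Set W) (G : IntLogic.IntFrame S),
          (F.IsKripke ∨ F.IsDescriptive) → (G.IsKripke ∨ G.IsDescriptive) →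
            F.IsFrameOf L → G.IsFrameOf L) ∧
        -- `L` is canonical
        IntLogic.IsCanonical.{u, v} L) := by
  refine ⟨fun W _ F S G hF _ φ hφ h =>
    IntLogic.beta_valid_of_substructure (IntLogic.IntFrame.isRefined hF) G hφ h,
    fun L _ hL => ⟨fun W _ F S G hF _ hFL φ hφ V hV x => ?_,
      fun W _ _ F hF hFL φ hφ V hV x => ?_⟩⟩
  · exact IntLogic.sat_of_orderEmbedding hL (IntLogic.IntFrame.isRefined hF) hFL
      (OrderEmbedding.subtype (· ∈ S)) (fun p => G.isUpperSet _ (hV p)) hφ x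
  -- Canonicity is the case of the identity embedding, with arbitrary upsets as values of the
  -- valuation.
  · exact IntLogic.sat_of_orderEmbedding hL hF.refined hFL
      (RelEmbedding.refl (· ≤ ·)) hV hφ x
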